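/- Let $X\subset\mathbb{N}$, let $\hat\Sigma=X^{\mathbb{Z}}$ and $\Sigma=X^{\mathbb{Z}_{\ge 0}}$ carry the product topologies ($X$ discrete), with two-sided shift $\hat\sigma$ on $\hat\Sigma$ and one-sided shift $\sigma$ on $\Sigma$, and let $P:\hat\Sigma\to\Sigma$ be the projection that forgets the coordinates with negative index. Let $K$ be a compact metrizable space (for example a compact Riemannian manifold), $\hat M=\hat\Sigma\times K$ and $M=\Sigma\times K$. Let $\hat f:\hat M\to\hat M$ be a homeomorphism of the form $\hat f(\hat x,t)=(\hat\sigma(\hat x),f_{P(\hat x)}(t))$, so that the fibre maps depend only on $P(\hat x)$, and put $f(x,t)=(\sigma(x),f_x(t))$ on $M$. Let $\hat A:\hat M\to GL(d,\mathbb{C})$ be a continuous map of the form $\hat A=A\circ(P\times\operatorname{id}_K)$ with $A:M\to GL(d,\mathbb{C})$, and write $A^n(p)=A(f^{n-1}(p))\cdots A(f(p))A(p)$ for $p\in M$ and $n\ge 0$ (so $A^0(p)=\operatorname{id}$). Let $1\le l<d$, let $\operatorname{Grass}(l,d)$ be the Grassmannian of $l$-dimensional subspaces of $\mathbb{C}^d$,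 and let $\hat F(\hat q,V)=(\hat f(\hat q),\hat A(\hat q)V)$ on $\hat M\times\operatorname{Grass}(l,d)$. Let $\hat\mu$ be an $\hat f$-invariant Borel probability measure on $\hat M$, and let $\hat m$ be an $\hat F$-invariant Borel probability measure on $\hat M\times\operatorname{Grass}(l,d)$ that projects to $\hat\mu$ under $(\hat q,V)\mapsto\hat q$. Put $m=(P\times\operatorname{id}_K\times\operatorname{id}_{\operatorname{Grass}(l,d)})_*\hat m$. Let $\{\hat m_{\hat q}:\hat q\in\hat M\}$ and $\{m_q:q\in M\}$ be any disintegrations of $\hat m$ and of $m$ into (measurably varying) probability measures on $\operatorname{Grass}(l,d)$ along the fibres $\{\hat q\}\times\operatorname{Grass}(l,d)$ and $\{q\}\times\operatorname{Grass}(l,d)$. For $\hat q\in\hat M$ and $n\ge 0$ let $q_n=(P\times\operatorname{id}_K)(\hat f^{-n}(\hat q))$. Then for $\hat\mu$-almost every $\hat q\in\hat M$ the sequence of push-forwards $\big(A^n(q_n)_*m_{q_n}\big)_{n\ge 0}$ converges to $\hat m_{\hat q}$ in the weak$^*$ topology, that is, for every continuous $\varphi:\operatorname{Grass}(l,d)\to\mathbb{R}$,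 $$\lim_{n\to\infty}\int\varphi\,d\big(A^n(q_n)_*m_{q_n}\big)=\int\varphi\,d\hat m_{\hat q}.$$ -/

import Mathlib

open MeasureTheory ProbabilityTheory Filter Topology

/-- The two-sided shift on sequences of symbols from the alphabet `X`. -/
def shiftTwo {X : Set ℕ} (x : ℤ → X) : ℤ → X := fun n => x (n + 1)

/-- The one-sided shift on sequences of symbols from the alphabet `X`. -/
def shiftOne {X : Set ℕ} (x : ℕ → X) : ℕ → X := fun n => x (n + 1)

/-- The projection `P` forgetting the coordinates with negative index. -/
def projOne {X : Set ℕ} (x : ℤ → X) : ℕ → X := fun n => x (n : ℤ)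

/-- The map `P × id` on a product with a second factor `K`. -/
def projBase {X : Set ℕ} {K : Type*} (q : (ℤ → X) × K) : (ℕ → X) × K := (projOne q.1, q.2)

/-- The one-sided skew product `(x, t) ↦ (σ x, f_x t)` with fibre maps `fib x = f_x`. -/
def skewOne {X : Set ℕ} {K : Type*} (fib : (ℕ → X) → K → K) (q : (ℕ → X) × K) : (ℕ → X) × K :=
  (shiftOne q.1, fib q.1 q.2)

/-- The iterated product `A(f^{n-1} y) ⋯ A(f y) A(y)`. -/
def cocycleIter {Y G : Type*} [Monoid G] (f : Y → Y) (A : Y → G) : ℕ → Y → G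
  | 0, _ => 1
  | n + 1, y => A (f^[n] y) * cocycleIter f A n y

/-- The Grassmannian of `l`-dimensional linear subspaces of `ℂ^d`. -/
def Grass (l d : ℕ) : Type :=
  {V : Submodule ℂ (EuclideanSpace ℂ (Fin d)) // Module.finrank ℂ V = l}

namespace Grass

/-- The usual topology of the Grassmannian: a subspace is identified with the orthogonal
projection onto it, and projections are compared in the operator norm. -/
noncomputable instance (l d : ℕ) : TopologicalSpace (Grass l d) :=
  TopologicalSpace.induced (fun V => V.1.starProjection) inferInstance

/-- The Borel sigma-algebra of the Grassmannian. -/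
noncomputable instance (l d : ℕ) : MeasurableSpace (Grass l d) := borel _

instance (l d : ℕ) : BorelSpace (Grass l d) := ⟨rfl⟩

lemma toEuclideanLin_injective {d : ℕ} (g : GL (Fin d) ℂ) :
    Function.Injective (Matrix.toEuclideanLin (g : Matrix (Fin d) (Fin d) ℂ)) := by
  refine Function.LeftInverse.injective
    (g := Matrix.toEuclideanLin ((g⁻¹ : GL (Fin d) ℂ) : Matrix (Fin d) (Fin d) ℂ)) fun v => ?_
  have h : ((g⁻¹ : GL (Fin d) ℂ) : Matrix (Fin d) (Fin d) ℂ) * g = 1 := by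
    rw [← Units.val_mul, inv_mul_cancel, Units.val_one]
  ext i
  simp [Matrix.toLpLin_apply, Matrix.mulVec_mulVec, h, -Matrix.coe_units_inv]

/-- The action `V ↦ g V` of an invertible matrix on the Grassmannian. -/
noncomputable def act {l d : ℕ} (g : GL (Fin d) ℂ) (V : Grass l d) : Grass l d :=
  ⟨V.1.map (Matrix.toEuclideanLin (g : Matrix (Fin d) (Fin d) ℂ)),
    (LinearEquiv.finrank_eq (Submodule.equivMapOfInjective _ (toEuclideanLin_injective g) V.1)).symm.trans
      V.2⟩

end Grass

/-- The action `(q, V) ↦ (f q, A(q) V)` of a linear cocycle on the Grassmannian bundle. -/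
noncomputable def grassCocycle {Y : Type*} {d : ℕ} (l : ℕ) (f : Y → Y) (A : Y → GL (Fin d) ℂ)
    (q : Y × Grass l d) : Y × Grass l d :=
  (f q.1, Grass.act (A q.1) q.2)

/-! The proof is a martingale argument. Since `q_n = f(q_{n+1})`, the sigma-algebras `ℱ n` generated
by `q ↦ q_n` increase with `n`. They generate everything, because `q_n` records the coordinates of
index at least `-n` and `q_0` records the point of `K`. Fix a test function `φ` and put `g(q) = ∫ φ
d(mhat_q)`. Invariance of `mhat` shows that integrating `φ` against `A^n(q_n)_* m_{q_n}` gives the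
conditional expectation of `g` given `ℱ n`, so Lévy's upward theorem yields convergence to `g`
almost everywhere (`ae_tendsto_integral_condKernel`). The null set depends on `φ`. As the
Grassmannian is compact and metrizable, its continuous functions form a separable space, and one
null set serves for all `φ` (`ae_forall_tendsto_integral`). -/

namespace Grass

/-! ### The Grassmannian as a compact metrizable space with a linear action -/

variable {l d : ℕ}

lemma starProjection_injective :
    Function.Injective (fun V : Grass l d => V.1.starProjection) :=
  fun _ _ h => Subtype.ext (Submodule.starProjection_inj.1 h)

lemma isEmbedding_starProjection :
    IsEmbedding (fun V : Grass l d => V.1.starProjection) :=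
  ⟨⟨rfl⟩, starProjection_injective⟩

instance : TopologicalSpace.MetrizableSpace (Grass l d) :=
  isEmbedding_starProjection.metrizableSpace

lemma trace_starProjection {E : Type*} [NormedAddCommGroup E] [InnerProductSpace ℂ E]
    [FiniteDimensional ℂ E] (V : Submodule ℂ E) :
    LinearMap.trace ℂ E V.starProjection = Module.finrank ℂ V :=
  LinearMap.IsProj.trace (p := V)
    ⟨fun x => V.starProjection_apply_mem x, fun _ hx => Submodule.starProjection_eq_self_iff.2 hx⟩

/-- The trace of a projection is its rank, so the dimension condition becomes a closed equation;
compactness of the Grassmannian rests on this. -/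
lemma range_starProjection_eq :
    Set.range (fun V : Grass l d => V.1.starProjection) =
      {p : EuclideanSpace ℂ (Fin d) →L[ℂ] EuclideanSpace ℂ (Fin d) | IsStarProjection p ∧
        LinearMap.trace ℂ (EuclideanSpace ℂ (Fin d)) p.toLinearMap = l} := by
  ext p
  constructor
  · rintro ⟨V, rfl⟩
    exact ⟨isStarProjection_starProjection, by rw [trace_starProjection, V.2]⟩
  · rintro ⟨hp, ht⟩
    obtain ⟨V, _, rfl⟩ := isStarProjection_iff_eq_starProjection.1 hp
    refine ⟨⟨V, ?_⟩, rfl⟩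
    have := trace_starProjection V
    exact_mod_cast this.symm.trans ht

lemma isClosed_range_starProjection :
    IsClosed (Set.range (fun V : Grass l d => V.1.starProjection)) := by
  rw [range_starProjection_eq]
  simp only [isStarProjection_iff, IsIdempotentElem, IsSelfAdjoint]
  refine ((isClosed_eq (by fun_prop) (by fun_prop)).inter
    (isClosed_eq continuous_star continuous_id)).inter (isClosed_eq ?_ continuous_const)
  exact ((LinearMap.trace ℂ (EuclideanSpace ℂ (Fin d))).comp
    (ContinuousLinearMap.coeLM ℂ)).continuous_of_finiteDimensional

instance : CompactSpace (Grass l d) := by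
  rw [← isCompact_univ_iff, isEmbedding_starProjection.isCompact_iff, Set.image_univ]
  refine Metric.isCompact_of_isClosed_isBounded isClosed_range_starProjection
    ((Metric.isBounded_closedBall (x := 0) (r := 1)).subset ?_)
  rintro _ ⟨V, rfl⟩
  simpa using V.1.starProjection_norm_le

lemma act_one (V : Grass l d) : act 1 V = V := by
  apply Subtype.ext
  simp [act]

lemma act_mul (g h : GL (Fin d) ℂ) (V : Grass l d) : act (g * h) V = act g (act h V) := by
  apply Subtype.ext
  simp only [act, Units.val_mul, ← Submodule.map_comp]
  congr 1
  ext v : 1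
  simp [Matrix.toLpLin_apply, Matrix.mulVec_mulVec]

end Grass

lemma grassCocycle_iterate {Y : Type*} {l d : ℕ} (f : Y → Y) (A : Y → GL (Fin d) ℂ) (n : ℕ)
    (p : Y × Grass l d) :
    (grassCocycle l f A)^[n] p = (f^[n] p.1, Grass.act (cocycleIter f A n p.1) p.2) := by
  induction n with
  | zero => simp [cocycleIter, Grass.act_one]
  | succ n ih =>
    rw [Function.iterate_succ_apply', Function.iterate_succ_apply', ih]
    simp [grassCocycle, cocycleIter, Grass.act_mul]

lemma cocycleIter_semiconj {Y Z G : Type*} [Monoid G] {f : Y → Y} {g : Z → Z} {π : Y → Z}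
    (h : Function.Semiconj π f g) {A : Y → G} {B : Z → G} (hAB : ∀ y, A y = B (π y)) (n : ℕ)
    (y : Y) : cocycleIter f A n y = cocycleIter g B n (π y) := by
  induction n with
  | zero => rfl
  | succ n ih => simp only [cocycleIter, ih, hAB, (h.iterate_right n).eq]

/-! ### Martingale convergence of conditional measures -/

section Disintegration

variable {Ω M Y : Type*} [MeasurableSpace Ω] [MeasurableSpace M] [MeasurableSpace Y]

/-- Integrating a product of bounded functions of the two coordinates fibre by fibre. -/
lemma integral_mul_condKernel (m : Measure (Ω × Y)) [IsProbabilityMeasure m] (κ : Kernel Ω Y)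
    [IsMarkovKernel κ] [m.IsCondKernel κ] {H : Ω → ℝ} (hH : Measurable H) {C : ℝ}
    (hHC : ∀ q, ‖H q‖ ≤ C) {φ : Ω × Y → ℝ} (hφ : Measurable φ) {D : ℝ} (hφD : ∀ p, ‖φ p‖ ≤ D) :
    ∫ p, H p.1 * φ p ∂m = ∫ q, H q * ∫ y, φ (q, y) ∂κ q ∂m.fst := by
  have hint : Integrable (fun p : Ω × Y => H p.1 * φ p) (m.fst ⊗ₘ κ) := by
    refine Integrable.of_bound ((hH.comp measurable_fst).mul hφ).aestronglyMeasurable (C * D)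
      (Eventually.of_forall fun p => ?_)
    rw [norm_mul]
    exact mul_le_mul (hHC _) (hφD _) (norm_nonneg _) ((norm_nonneg _).trans (hHC p.1))
  conv_lhs => rw [← m.disintegrate κ]
  rw [Measure.integral_compProd hint]
  simp only [integral_const_mul]

/-- The skew product `(q, y) ↦ (e^n q, T_n(π q) y)` over an invertible map preserves `m`.
The push-forwards, by the fibre maps from time `-n` to time `0`, of the conditional measures of the
factor form a martingale that converges to the conditional measures of `m`. -/
theorem ae_tendsto_integral_condKernel (e : Ω ≃ᵐ Ω) {π : Ω → M} (hπ : Measurable π) {f : M → M}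
    (hf : Measurable f) (hπf : Function.Semiconj π e f)
    (hgen : ‹MeasurableSpace Ω› ≤
      ⨆ n : ℕ, MeasurableSpace.comap (fun q => π (e.symm^[n] q)) inferInstance)
    (T : ℕ → M → Y → Y) (hT : ∀ n, Measurable (Function.uncurry (T n)))
    (m : Measure (Ω × Y)) [IsProbabilityMeasure m]
    (hm : ∀ n, MeasurePreserving (fun p : Ω × Y => (e^[n] p.1, T n (π p.1) p.2)) m m)
    (κΩ : Kernel Ω Y) [IsMarkovKernel κΩ] [m.IsCondKernel κΩ]
    (κM : Kernel M Y) [IsMarkovKernel κM] [(m.map (Prod.map π id)).IsCondKernel κM]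
    {φ : Y → ℝ} (hφ : Measurable φ) {C : ℝ} (hφC : ∀ y, ‖φ y‖ ≤ C) :
    ∀ᵐ q ∂m.fst, Tendsto
      (fun n : ℕ => ∫ y, φ (T n (π (e.symm^[n] q)) y) ∂κM (π (e.symm^[n] q)))
      atTop (𝓝 (∫ y, φ y ∂κΩ q)) := by
  have hme (n : ℕ) : Measurable (fun q => π (e.symm^[n] q)) := hπ.comp (e.symm.measurable.iterate n)
  let ℱ : Filtration ℕ ‹MeasurableSpace Ω› :=
    { seq := fun n => MeasurableSpace.comap (fun q => π (e.symm^[n] q)) inferInstance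
      mono' := monotone_nat_of_le_succ fun n => by
        -- The point at time `-n` is the image under `f` of the point at time `-(n+1)`.
        have h : (fun q => π (e.symm^[n] q)) = f ∘ fun q => π (e.symm^[n + 1] q) := by
          ext q
          simp only [Function.comp_apply, Function.iterate_succ_apply', ← hπf.eq,
            MeasurableEquiv.apply_symm_apply]
        rw [h, ← MeasurableSpace.comap_comp]
        exact MeasurableSpace.comap_mono hf.comap_le
      le' := fun n => (hme n).comap_le }
  let g : Ω → ℝ := fun q => ∫ y, φ y ∂κΩ q
  let Φ : ℕ → M → ℝ := fun n x => ∫ y, φ (T n x y) ∂κM x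
  have hφT (n : ℕ) : Measurable (fun p : M × Y => φ (T n p.1 p.2)) := hφ.comp (hT n)
  have hgm : StronglyMeasurable g :=
    hφ.stronglyMeasurable.integral_kernel
  have hΦm (n : ℕ) : StronglyMeasurable (Φ n) :=
    StronglyMeasurable.integral_kernel_prod_right' (hφT n).stronglyMeasurable
  have hgC (q : Ω) : ‖g q‖ ≤ C := by
    simpa using norm_integral_le_of_norm_le_const (μ := κΩ q) (Eventually.of_forall hφC)
  have hΦC (n : ℕ) (x : M) : ‖Φ n x‖ ≤ C := by
    simpa using norm_integral_le_of_norm_le_const (μ := κM x)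
      (Eventually.of_forall fun y => hφC (T n x y))
  have hgi : Integrable g m.fst :=
    Integrable.of_bound hgm.aestronglyMeasurable C (Eventually.of_forall hgC)
  have hΦi (n : ℕ) : Integrable (fun q => Φ n (π (e.symm^[n] q))) m.fst :=
    Integrable.of_bound ((hΦm n).comp_measurable (hme n)).aestronglyMeasurable C
      (Eventually.of_forall fun q => hΦC n _)
  have hπid : Measurable (Prod.map π (id : Y → Y)) := hπ.prodMap measurable_id
  have : IsProbabilityMeasure (m.map (Prod.map π (id : Y → Y))) :=
    Measure.isProbabilityMeasure_map hπid.aemeasurable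
  have hsymm (n : ℕ) (q : Ω) : e.symm^[n] (e^[n] q) = q :=
    (Function.LeftInverse.iterate e.symm_apply_apply n) q
  -- Here `H` tests against functions of `q_n`. Invariance of `m` replaces `q_n` by `π q`, the
  -- integral is then computed on the factor through `κM`, and invariance is used backwards to
  -- absorb `T n` into the fibre variable.
  have key (n : ℕ) {H : M → ℝ} (hH : Measurable H) (hH1 : ∀ x, ‖H x‖ ≤ 1) :
      ∫ q, H (π (e.symm^[n] q)) * Φ n (π (e.symm^[n] q)) ∂m.fst =
        ∫ q, H (π (e.symm^[n] q)) * g q ∂m.fst := by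
    have hHφ : Measurable (fun p : M × Y => H p.1 * φ (T n p.1 p.2)) :=
      (hH.comp measurable_fst).mul (hφT n)
    have hHΦ : Measurable (fun x => H x * Φ n x) := hH.mul (hΦm n).measurable
    calc
      _ = ∫ p, H (π (e.symm^[n] p.1)) * Φ n (π (e.symm^[n] p.1)) ∂m := by
        rw [Measure.fst, integral_map measurable_fst.aemeasurable]
        exact (hHΦ.comp (hme n)).aestronglyMeasurable
      _ = ∫ p, H (π p.1) * Φ n (π p.1) ∂m := by
        conv_lhs => rw [← (hm n).map_eq]
        rw [integral_map (hm n).measurable.aemeasurable]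
        · simp only [hsymm]
        · exact (hHΦ.comp ((hme n).comp measurable_fst)).aestronglyMeasurable
      _ = ∫ x, H x * Φ n x ∂(m.map (Prod.map π id)).fst := by
        rw [Measure.fst, Measure.map_map measurable_fst hπid,
          integral_map (measurable_fst.comp hπid).aemeasurable hHΦ.aestronglyMeasurable]
        rfl
      _ = ∫ p, H p.1 * φ (T n p.1 p.2) ∂(m.map (Prod.map π id)) :=
        (integral_mul_condKernel _ κM hH hH1 (hφT n) fun p => hφC _).symm
      _ = ∫ p, H (π p.1) * φ (T n (π p.1) p.2) ∂m := by
        rw [integral_map hπid.aemeasurable hHφ.aestronglyMeasurable]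
        rfl
      _ = ∫ p, H (π (e.symm^[n] p.1)) * φ p.2 ∂m := by
        conv_rhs => rw [← (hm n).map_eq]
        rw [integral_map (hm n).measurable.aemeasurable]
        · simp only [hsymm]
        · exact ((hH.comp ((hme n).comp measurable_fst)).mul
            (hφ.comp measurable_snd)).aestronglyMeasurable
      _ = _ := integral_mul_condKernel m κΩ (hH.comp (hme n)) (fun q => hH1 _)
        (hφ.comp measurable_snd) fun p => hφC _
  have hcond (n : ℕ) :
      (fun q => Φ n (π (e.symm^[n] q))) =ᵐ[m.fst] m.fst[g | ℱ n] := by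
    refine ae_eq_condExp_of_forall_setIntegral_eq (ℱ.le n) hgi
      (fun _ _ _ => (hΦi n).integrableOn) ?_
      (((hΦm n).comp_measurable (comap_measurable _)).aestronglyMeasurable)
    rintro _ ⟨B, hB, rfl⟩ -
    -- A set of `ℱ n` is the preimage of some `B`, so the indicator of `B` serves as `H`.
    have h := key n (measurable_one.indicator hB) fun x => by
      by_cases hx : x ∈ B <;> simp [hx]
    rw [← integral_indicator (hme n hB), ← integral_indicator (hme n hB)]
    convert h using 2 with q q <;>
    · ext q
      by_cases hq : π (e.symm^[n] q) ∈ B <;> simp [hq]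
  -- By `hgen`, `g` is measurable for the supremum of the `ℱ n`, so the limit is `g` itself.
  have hlim := hgi.tendsto_ae_condExp (ℱ := ℱ) (hgm.mono hgen)
  filter_upwards [hlim, ae_all_iff.2 hcond] with q hq hq'
  exact hq.congr fun n => (hq' n).symm

end Disintegration

/-- Uniform limits of test functions preserve convergence of integrals, so that a countable dense
family of test functions suffices. -/
lemma ae_forall_tendsto_integral {Ω Y : Type*} [MeasurableSpace Ω] [TopologicalSpace Y]
    [CompactSpace Y] [TopologicalSpace.MetrizableSpace Y] [MeasurableSpace Y] [BorelSpace Y]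
    (μ : Measure Ω) (ν : ℕ → Ω → Measure Y) [∀ n q, IsProbabilityMeasure (ν n q)]
    (ρ : Ω → Measure Y) [∀ q, IsProbabilityMeasure (ρ q)]
    (h : ∀ φ : C(Y, ℝ), ∀ᵐ q ∂μ,
      Tendsto (fun n => ∫ y, φ y ∂ν n q) atTop (𝓝 (∫ y, φ y ∂ρ q))) :
    ∀ᵐ q ∂μ, ∀ φ : C(Y, ℝ), Tendsto (fun n => ∫ y, φ y ∂ν n q) atTop (𝓝 (∫ y, φ y ∂ρ q)) := by
  let _ := TopologicalSpace.metrizableSpaceMetric Y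
  have hint (φ : C(Y, ℝ)) (θ : Measure Y) [IsProbabilityMeasure θ] : Integrable φ θ :=
    Integrable.of_bound φ.continuous.measurable.aestronglyMeasurable ‖φ‖
      (Eventually.of_forall φ.norm_coe_le_norm)
  have hdist (φ ψ : C(Y, ℝ)) (θ : Measure Y) [IsProbabilityMeasure θ] :
      dist (∫ y, φ y ∂θ) (∫ y, ψ y ∂θ) ≤ dist φ ψ := by
    rw [dist_eq_norm, ← integral_sub (hint φ θ) (hint ψ θ), dist_eq_norm]
    simpa using norm_integral_le_of_norm_le_const (μ := θ)
      (Eventually.of_forall (φ - ψ).norm_coe_le_norm)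
  filter_upwards [ae_all_iff.2 fun k => h (TopologicalSpace.denseSeq C(Y, ℝ) k)] with q hq φ
  rw [Metric.tendsto_atTop]
  intro ε hε
  obtain ⟨_, hψ, k, rfl⟩ := Metric.dense_iff.1 (TopologicalSpace.denseRange_denseSeq C(Y, ℝ)) φ
    (ε / 3) (by positivity)
  set ψ := TopologicalSpace.denseSeq C(Y, ℝ) k
  obtain ⟨N, hN⟩ := Metric.tendsto_atTop.1 (hq k) (ε / 3) (by positivity)
  refine ⟨N, fun n hn => ?_⟩
  have h1 := hdist φ ψ (ν n q)
  have h2 := hdist ψ φ (ρ q)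
  have h3 := hN n hn
  rw [Metric.mem_ball] at hψ
  rw [dist_comm φ ψ] at h1
  have h4 := dist_triangle4 (∫ y, φ y ∂ν n q) (∫ y, ψ y ∂ν n q) (∫ y, ψ y ∂ρ q)
    (∫ y, φ y ∂ρ q)
  linarith

/-! ### The two-sided shift and its one-sided factor -/

section Shift

variable {X : Set ℕ} {K : Type*}

/-- A section of `projBase`: the coordinates with negative index repeat the one of index `0`. -/
def sectionBase (p : (ℕ → X) × K) : (ℤ → X) × K := (fun n => p.1 n.toNat, p.2)

lemma projBase_sectionBase (p : (ℕ → X) × K) : projBase (sectionBase p) = p := by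
  rfl

lemma semiconj_projBase {fhat : (ℤ → X) × K → (ℤ → X) × K} {fib : (ℕ → X) → K → K}
    (hf : ∀ (x : ℤ → X) (t : K), fhat (x, t) = (shiftTwo x, fib (projOne x) t)) :
    Function.Semiconj projBase fhat (skewOne fib) := by
  rintro ⟨x, t⟩
  rw [hf]
  rfl

lemma measurable_projBase [MeasurableSpace K] : Measurable (projBase : (ℤ → X) × K → (ℕ → X) × K) := by
  unfold projBase projOne
  fun_prop

lemma measurable_sectionBase [MeasurableSpace K] : Measurable (sectionBase : (ℕ → X) × K → (ℤ → X) × K) := by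
  unfold sectionBase
  fun_prop

lemma fst_symm_iterate {e : ((ℤ → X) × K) ≃ ((ℤ → X) × K)} {fib : (ℕ → X) → K → K}
    (hf : ∀ (x : ℤ → X) (t : K), e (x, t) = (shiftTwo x, fib (projOne x) t)) (n : ℕ)
    (q : (ℤ → X) × K) (k : ℤ) : (e.symm^[n] q).1 k = q.1 (k - n) := by
  induction n generalizing k with
  | zero => simp
  | succ n ih =>
    have h := congrArg Prod.fst (e.apply_symm_apply (e.symm^[n] q))
    rw [← Prod.mk.eta (p := e.symm (e.symm^[n] q)), hf] at h
    -- The shift reads one index further, so index `k - 1` gives coordinate `k` of the preimage.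
    have h' := congrFun h (k - 1)
    rw [ih] at h'
    rw [Function.iterate_succ_apply']
    simp only [shiftTwo, sub_add_cancel] at h'
    rw [h']
    rw [Nat.cast_succ, sub_right_comm, sub_sub]

/-- The pasts of a point, seen through `projBase`, determine the point. -/
lemma le_iSup_comap_projBase [MeasurableSpace K] {e : ((ℤ → X) × K) ≃ ((ℤ → X) × K)} {fib : (ℕ → X) → K → K}
    (hf : ∀ (x : ℤ → X) (t : K), e (x, t) = (shiftTwo x, fib (projOne x) t)) :
    (inferInstance : MeasurableSpace ((ℤ → X) × K)) ≤
      ⨆ n : ℕ, MeasurableSpace.comap (fun q => projBase (e.symm^[n] q)) inferInstance := by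
  set 𝒢 : MeasurableSpace ((ℤ → X) × K) :=
    ⨆ n : ℕ, MeasurableSpace.comap (fun q => projBase (e.symm^[n] q)) inferInstance
  have hn (n : ℕ) : Measurable[𝒢] (fun q => projBase (e.symm^[n] q)) :=
    (comap_measurable _).mono (le_iSup (fun n : ℕ =>
      MeasurableSpace.comap (fun q => projBase (e.symm^[n] q)) inferInstance) n) le_rfl
  have h1 : Measurable[𝒢] (Prod.fst : (ℤ → X) × K → ℤ → X) := by
    refine measurable_pi_iff.2 fun k => ?_
    -- Going back `|k|` steps moves coordinate `k` to the index `k + |k| ≥ 0`, which survives the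
    -- projection.
    have h : (fun q : (ℤ → X) × K => q.1 k) =
        fun q => (projBase (e.symm^[k.natAbs] q)).1 (k + k.natAbs).toNat := by
      ext q
      simp only [projBase, projOne, fst_symm_iterate hf]
      have hk : ((k + k.natAbs).toNat : ℤ) - k.natAbs = k := by omega
      rw [hk]
    rw [h]
    exact (measurable_pi_apply _).comp (measurable_fst.comp (hn _))
  have h2 : Measurable[𝒢] (Prod.snd : (ℤ → X) × K → K) := by
    have h := measurable_snd.comp (hn 0)
    exact h
  exact sup_le h1.comap_le h2.comap_le

end Shift

theorem propositionp
    {X : Set ℕ}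
    {K : Type*} [TopologicalSpace K] [CompactSpace K] [TopologicalSpace.MetrizableSpace K]
    [MeasurableSpace K] [BorelSpace K]
    (l d : ℕ) (hl : 1 ≤ l) (hld : l < d)
    -- the skew product over the two-sided shift, with fibre maps depending only on `P x`
    (fhat : ((ℤ → X) × K) ≃ₜ ((ℤ → X) × K))
    (fib : (ℕ → X) → K → K)
    (hf : ∀ (x : ℤ → X) (t : K), fhat (x, t) = (shiftTwo x, fib (projOne x) t))
    -- the linear cocycle, depending only on `(P x, t)`
    (Ahat : (ℤ → X) × K → GL (Fin d) ℂ) (hAcont : Continuous Ahat)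
    (A : (ℕ → X) × K → GL (Fin d) ℂ) (hA : ∀ q, Ahat q = A (projBase q))
    -- the invariant measure on the base, and an invariant measure that projects to it
    (muhat : Measure ((ℤ → X) × K)) [IsProbabilityMeasure muhat]
    (hmu : MeasurePreserving fhat muhat muhat)
    (mhat : Measure (((ℤ → X) × K) × Grass l d)) [IsProbabilityMeasure mhat]
    (hproj : mhat.map Prod.fst = muhat)
    (hm : MeasurePreserving (grassCocycle l fhat Ahat) mhat mhat)
    -- disintegrations of `mhat` and of its one-sided projection along the Grassmannian fibres
    (mhatDis : Kernel ((ℤ → X) × K) (Grass l d)) [IsMarkovKernel mhatDis]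
    [mhat.IsCondKernel mhatDis]
    (mDis : Kernel ((ℕ → X) × K) (Grass l d)) [IsMarkovKernel mDis]
    [(mhat.map (Prod.map projBase id)).IsCondKernel mDis] :
    ∀ᵐ q ∂muhat, ∀ φ : C(Grass l d, ℝ),
      Tendsto
        (fun n : ℕ =>
          ∫ V, φ V ∂((mDis (projBase (fhat.symm^[n] q))).map
            (Grass.act (cocycleIter (skewOne fib) A n (projBase (fhat.symm^[n] q))))))
        atTop (𝓝 (∫ V, φ V ∂(mhatDis q))) := by

  let e : ((ℤ → X) × K) ≃ᵐ ((ℤ → X) × K) := fhat.toMeasurableEquiv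
  have hsemi : Function.Semiconj projBase fhat (skewOne fib) := semiconj_projBase hf
  have hfm : Measurable (skewOne fib : (ℕ → X) × K → (ℕ → X) × K) := by
    -- Measurability of the one-sided map is inherited from `fhat` through the section; the same
    -- device gives `hT` below.
    have h : skewOne fib = projBase ∘ fhat ∘ sectionBase := by
      ext1 p
      simp only [Function.comp_apply, hsemi.eq, projBase_sectionBase]
    rw [h]
    exact measurable_projBase.comp (fhat.measurable.comp measurable_sectionBase)
  have hiter (n : ℕ) (p : ((ℤ → X) × K) × Grass l d) :
      (grassCocycle l fhat Ahat)^[n] p =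
        (fhat^[n] p.1, Grass.act (cocycleIter (skewOne fib) A n (projBase p.1)) p.2) := by
    rw [grassCocycle_iterate, cocycleIter_semiconj hsemi hA]
  let T (n : ℕ) (x : (ℕ → X) × K) : Grass l d → Grass l d :=
    Grass.act (cocycleIter (skewOne fib) A n x)
  have hT (n : ℕ) : Measurable (Function.uncurry (T n)) := by
    have h : Function.uncurry (T n) =
        fun p => ((grassCocycle l fhat Ahat)^[n] (sectionBase p.1, p.2)).2 := by
      ext1 p
      rw [hiter, projBase_sectionBase]
      rfl
    rw [h]
    exact measurable_snd.comp ((hm.measurable.iterate n).comp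
      ((measurable_sectionBase.comp measurable_fst).prodMk measurable_snd))
  have hTx (n : ℕ) (x : (ℕ → X) × K) : Measurable (T n x) :=
    (hT n).of_uncurry_left
  have hpres (n : ℕ) : MeasurePreserving
      (fun p : ((ℤ → X) × K) × Grass l d => (e^[n] p.1, T n (projBase p.1) p.2)) mhat mhat := by
    convert hm.iterate n using 1
    ext1 p
    exact (hiter n p).symm
  -- The base measure becomes the first marginal of `mhat`, as the martingale theorem requires.
  rw [← hproj]
  have (n : ℕ) (q : (ℤ → X) × K) : IsProbabilityMeasure
      ((mDis (projBase (fhat.symm^[n] q))).map (T n (projBase (fhat.symm^[n] q)))) :=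
    Measure.isProbabilityMeasure_map (hTx n _).aemeasurable
  refine ae_forall_tendsto_integral _ (fun n q => (mDis (projBase (fhat.symm^[n] q))).map
    (T n (projBase (fhat.symm^[n] q)))) (fun q => mhatDis q) fun φ => ?_
  have h := ae_tendsto_integral_condKernel e measurable_projBase hfm hsemi
    (le_iSup_comap_projBase (e := fhat.toEquiv) hf) T hT mhat hpres mhatDis mDis
    φ.continuous.measurable φ.norm_coe_le_norm
  filter_upwards [h] with q hq
  refine hq.congr fun n => ?_
  exact (integral_map (hTx n _).aemeasurable
    φ.continuous.measurable.aestronglyMeasurable).symm
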